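/- Let $p$ be a prime, let $S\subseteq \mathbb{Z}/p\mathbb{Z}$ with $|S|=m\geq 1$, and let $A\subseteq \mathbb{Z}/p\mathbb{Z}$ satisfy $$|A|\geq \sqrt{4mp+4m(m-3)+2}-m+1.$$ Put $n=\left\lfloor\frac{|A|-1+m}{2m}\right\rfloor$. Then every $x\in\mathbb{Z}/p\mathbb{Z}$ can be written in the form $x=a_1+\cdots+a_n$ with $a_1,\dots,a_n\in A$ and $a_i-a_j\notin S$ whenever $1\leq i,j\leq n$ and $i\neq j$. -/

import Mathlib

/-!
The proof is by the polynomial method, with the coefficient evaluated by interpolation.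

For `u : Fin (2 * m) → ZMod p` and `v : Fin (p - 1) → ZMod p` let `gapSumPoly n u v` be the
polynomial `(∏ i < j, ∏ t, (X j - X i - u t)) * ∏ t, (∑ i, X i - v t)`. When `u` enumerates
`S` and `-S`, and `v` enumerates the residues other than `x`, a point of `A ^ n` at which the
polynomial does not vanish is a representation of `x` of the required kind. By the combinatorial
Nullstellensatz such a point exists as soon as some top-degree monomial `∏ i, X i ^ t i` with
`t i < A.card` for all `i` has a nonzero coefficient. The square-root bound on `A.card` guarantees
that the degree `m * n * (n - 1) + (p - 1)` is at most `n * (A.card - 1)` (`size_bounds`), so there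
is room for such a monomial; the exponents are chosen to be `K` for the first indices and `K - 1`
for the remaining ones.

The coefficient in question depends only on the linear parts of the factors
(`coeff_gapSumPoly_eq`), so `u` and `v` may be replaced by any others. Take `u` to run through the
integers from `-m` to `m - 1`, and `v` through the `p - 1` integers following
`μ = m * (n * (n - 1) / 2)`. On the grid `∏ i, {0, …, t i}`, a point where the first product does
not vanish has coordinates at mutual distance at least `m`, and at least `m + 1` for two coordinates
in the opposite order to their indices (`IsGapped`). Its sum is at least `μ`, with equality only at
`(0, m, …, (n - 1) * m)`, and at most `μ + (p - 1)`: the extra `1` in the distances makes up for the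
exponents `K - 1`. So this is the only grid point where the polynomial is nonzero (modulo `p` too,
as `n * m < p`), and by `coeff_ne_zero_of_unique_eval_ne_zero` the coefficient does not vanish.
-/

/-! ### Top-degree coefficients of products of linear polynomials -/

open MvPolynomial in
/-- In top degree, a product of linear polynomials does not depend on their constant terms. -/
theorem coeff_prod_sub_C {σ ι R : Type*} [CommRing R] (s : Finset ι) (L : ι → MvPolynomial σ R)
    (a : ι → R) (hL : ∀ q ∈ s, (L q).totalDegree ≤ 1) (t : σ →₀ ℕ) (ht : s.card ≤ t.degree) :
    coeff t (∏ q ∈ s, (L q - C (a q))) = coeff t (∏ q ∈ s, L q) := by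
  classical
  simp_rw [sub_eq_add_neg, ← C_neg]
  rw [Finset.prod_add, coeff_sum, Finset.sum_eq_single s]
  · simp
  · intro u hu hus
    rw [Finset.mem_powerset] at hu
    rw [← map_prod, mul_comm, coeff_C_mul]
    have hlt : u.card < s.card := Finset.card_lt_card (hu.ssubset_of_ne hus)
    have hdeg : (∏ q ∈ u, L q).totalDegree ≤ u.card :=
      (totalDegree_finsetProd _ _).trans <| by
        simpa using Finset.sum_le_card_nsmul u _ 1 fun q hq => hL q (hu hq)
    rw [coeff_eq_zero_of_totalDegree_lt, mul_zero]
    exact (hdeg.trans_lt hlt).trans_le ht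
  · simp

open MvPolynomial in
theorem totalDegree_prod_sub_C_le {σ ι R : Type*} [CommRing R] (s : Finset ι)
    (L : ι → MvPolynomial σ R) (a : ι → R) (hL : ∀ q ∈ s, (L q).totalDegree ≤ 1) :
    (∏ q ∈ s, (L q - C (a q))).totalDegree ≤ s.card :=
  (totalDegree_finsetProd _ _).trans <| by
    simpa using Finset.sum_le_card_nsmul s _ 1 fun q hq =>
      (totalDegree_sub_C_le _ _).trans (hL q hq)

open MvPolynomial in
/-- A converse to the combinatorial Nullstellensatz: if a polynomial of degree at most `∑ i, t i`
has exactly one nonzero value on a grid with sides of size `t i + 1`, then its coefficient at `t`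
does not vanish. -/
theorem coeff_ne_zero_of_unique_eval_ne_zero {σ F : Type*} [Fintype σ] [Field F]
    (f : MvPolynomial σ F) (t : σ →₀ ℕ) (hf : f.totalDegree ≤ t.degree) (B : σ → Finset F)
    (hB : ∀ i, (B i).card = t i + 1) (c : σ → F) (hc : ∀ i, c i ∈ B i) (hfc : eval c f ≠ 0)
    (h : ∀ y : σ → F, (∀ i, y i ∈ B i) → y ≠ c → eval y f = 0) : coeff t f ≠ 0 := by
  classical
  intro h0
  set s : Finset ((_ : σ) × F) := Finset.univ.sigma fun i => (B i).erase (c i) with hs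
  set g : MvPolynomial σ F := ∏ q ∈ s, (X q.1 - C q.2) with hg
  -- `g` also vanishes on the grid except at `c`, and its coefficient at `t` is `1`; subtracting the
  -- right multiple of `g` from `f` gives a polynomial that vanishes on the whole grid.
  have hcard : s.card = t.degree := by
    simp [hs, Finset.card_sigma, Finset.card_erase_of_mem (hc _), hB, Finsupp.degree_eq_sum]
  have hgt : coeff t g = 1 := by
    rw [hg, coeff_prod_sub_C s (fun q => X q.1) (fun q => q.2) (by simp) t hcard.le,
      hs, Finset.prod_sigma]
    simp only [Finset.prod_const, Finset.card_erase_of_mem (hc _), hB, Nat.add_sub_cancel]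
    have : ∏ i, (X i : MvPolynomial σ F) ^ t i = monomial t 1 := by
      rw [monomial_eq, C_1, one_mul, Finsupp.prod_fintype _ _ (by simp)]
    rw [this, coeff_monomial, if_pos rfl]
  have hgdeg : g.totalDegree ≤ t.degree :=
    hcard ▸ totalDegree_prod_sub_C_le s (fun q => X q.1) (fun q => q.2) (by simp)
  have hgc : eval c g ≠ 0 := by
    rw [hg, map_prod, Finset.prod_ne_zero_iff]
    rintro ⟨i, b⟩ hq
    simp only [hs, Finset.mem_sigma, Finset.mem_univ, true_and, Finset.mem_erase] at hq
    simpa [sub_eq_zero] using hq.1.symm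
  have hgy : ∀ y : σ → F, (∀ i, y i ∈ B i) → y ≠ c → eval y g = 0 := by
    intro y hy hyc
    obtain ⟨i, hi⟩ := Function.ne_iff.1 hyc
    rw [hg, map_prod]
    exact Finset.prod_eq_zero (i := ⟨i, y i⟩) (by simp [hs, hi, hy i]) (by simp)
  set r := eval c f / eval c g with hr
  have hr0 : r ≠ 0 := div_ne_zero hfc hgc
  have hcoeff : coeff t (f - C r * g) ≠ 0 := by
    rw [coeff_sub, coeff_C_mul, h0, hgt]; simpa using hr0
  have hdeg : (f - C r * g).totalDegree = t.degree := by
    apply le_antisymm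
    · refine (totalDegree_sub _ _).trans (max_le hf ?_)
      exact (totalDegree_mul _ _).trans (by simpa using hgdeg)
    · exact le_totalDegree (mem_support_iff.2 hcoeff)
  obtain ⟨y, hy, hye⟩ := combinatorial_nullstellensatz_exists_eval_nonzero _ t hcoeff hdeg B
    fun i => by rw [hB]; exact Nat.lt_succ_self _
  apply hye
  rw [map_sub, map_mul, eval_C]
  by_cases hyc : y = c
  · rw [hyc, hr, div_mul_cancel₀ _ hgc, sub_self]
  · rw [h y hy hyc, hgy y hy hyc, mul_zero, sub_zero]

/-! ### Tuples of integers with prescribed gaps -/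

/-- The values of `y` are pairwise at distance at least `m`, and at distance at least `m + 1` when
they come in the opposite order to their indices. Equivalently, `y j - y i` avoids the `2 * m`
integers `-m, …, m - 1` for all `i < j`. -/
def IsGapped {n : ℕ} (m : ℕ) (y : Fin n → ℕ) : Prop :=
  ∀ i j, i < j → y i + m ≤ y j ∨ y j + m + 1 ≤ y i

namespace IsGapped

variable {n m : ℕ} {y : Fin n → ℕ}

theorem add_le_of_lt (h : IsGapped m y) {i j : Fin n} (hij : y i < y j) : y i + m ≤ y j := by
  rcases lt_trichotomy i j with h1 | h1 | h1
  · have := h i j h1; omega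
  · subst h1; omega
  · have := h j i h1; omega

theorem add_lt_of_lt (h : IsGapped m y) {i j : Fin n} (hij : y i < y j) (hji : j < i) :
    y i + m + 1 ≤ y j := by
  have := h j i hji; omega

theorem injective (h : IsGapped m y) (hm : 1 ≤ m) : Function.Injective y := by
  intro i j hij
  by_contra hne
  rcases lt_or_gt_of_ne hne with h1 | h1
  · have := h i j h1; omega
  · have := h j i h1; omega

/-- The value `y i` is at least `m` times its rank, and one more if some smaller value has a larger
index: the chain of values up to `y i` then contains a descent, which costs an extra `1`. -/
theorem mul_rank_add_le (h : IsGapped m y) (hm : 1 ≤ m) (i : Fin n) :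
    m * (Finset.univ.filter fun j => y j < y i).card + (if ∃ l, i < l ∧ y l < y i then 1 else 0)
      ≤ y i := by
  induction hv : y i using Nat.strong_induction_on generalizing i with
  | _ v ih =>
    subst hv
    rcases (Finset.univ.filter fun j => y j < y i).eq_empty_or_nonempty with he | hne
    · have hno : ¬ ∃ l, i < l ∧ y l < y i := by
        rintro ⟨l, -, hl⟩
        exact Finset.notMem_empty l (he ▸ by simpa using hl)
      simp [he, hno]
    · -- `j` carries the largest value below `y i`; the bound passes from `j` to `i`.
      obtain ⟨j, hj, hmax⟩ := Finset.exists_max_image _ y hne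
      simp only [Finset.mem_filter, Finset.mem_univ, true_and] at hj hmax
      have hsub : (Finset.univ.filter fun l => y l < y i) ⊆
          insert j (Finset.univ.filter fun l => y l < y j) := by
        intro l hl
        simp only [Finset.mem_filter, Finset.mem_univ, true_and, Finset.mem_insert] at hl ⊢
        rcases (hmax l hl).eq_or_lt with h1 | h1
        · exact Or.inl (h.injective hm h1)
        · exact Or.inr h1
      have hcard := (Finset.card_le_card hsub).trans (Finset.card_insert_le _ _)
      have hmul := Nat.mul_le_mul_left m hcard
      rw [Nat.mul_add, Nat.mul_one] at hmul
      have hj' := ih (y j) hj j rfl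
      have hgap := h.add_le_of_lt hj
      by_cases hi : ∃ l, i < l ∧ y l < y i
      · rw [if_pos hi]
        by_cases hjx : ∃ l, j < l ∧ y l < y j
        · rw [if_pos hjx] at hj'; omega
        · have hij : i < j := by
            obtain ⟨l, hil, hl⟩ := hi
            refine hil.trans_le (not_lt.1 fun hjl => hjx ⟨l, hjl, ?_⟩)
            exact lt_of_le_of_ne (hmax l hl) fun he => hjl.ne' (h.injective hm he)
          have := h.add_lt_of_lt hj hij
          omega
      · rw [if_neg hi]; omega

/-- If the indices from `r` on are confined to values below `K`, then `y i` is at most `K` minus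
`m` times its rank from the top, and one less if some index `l ≥ r` has a value that is at least
`y i`: either the topmost value has such an index, or there is a descent just above the highest value that
does, and both cost an extra `1`. -/
theorem add_mul_rank_add_le (h : IsGapped m y) (hm : 1 ≤ m) {K r : ℕ} (hK : ∀ i, y i ≤ K)
    (hr : ∀ i : Fin n, r ≤ i → y i < K) (i : Fin n) :
    y i + m * (Finset.univ.filter fun j => y i < y j).card +
      (if ∃ l : Fin n, r ≤ l ∧ y i ≤ y l then 1 else 0) ≤ K := by
  induction hv : K - y i using Nat.strong_induction_on generalizing i with
  | _ v ih =>
    subst hv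
    rcases (Finset.univ.filter fun j => y i < y j).eq_empty_or_nonempty with he | hne
    · rw [he, Finset.card_empty, mul_zero, add_zero]
      split_ifs with hi
      · obtain ⟨l, hl, hil⟩ := hi
        exact hil.trans_lt (hr l hl)
      · exact hK i
    · -- `j` carries the smallest value above `y i`; the bound passes from `j` to `i`.
      obtain ⟨j, hj, hmin⟩ := Finset.exists_min_image _ y hne
      simp only [Finset.mem_filter, Finset.mem_univ, true_and] at hj hmin
      have hsub : (Finset.univ.filter fun l => y i < y l) ⊆
          insert j (Finset.univ.filter fun l => y j < y l) := by
        intro l hl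
        simp only [Finset.mem_filter, Finset.mem_univ, true_and, Finset.mem_insert] at hl ⊢
        rcases (hmin l hl).eq_or_lt with h1 | h1
        · exact Or.inl (h.injective hm h1.symm)
        · exact Or.inr h1
      have hcard := (Finset.card_le_card hsub).trans (Finset.card_insert_le _ _)
      have hmul := Nat.mul_le_mul_left m hcard
      rw [Nat.mul_add, Nat.mul_one] at hmul
      have hj' := ih (K - y j) (by have := hK j; omega) j rfl
      have hgap := h.add_le_of_lt hj
      by_cases hi : ∃ l : Fin n, r ≤ l ∧ y i ≤ y l
      · rw [if_pos hi]
        by_cases hjx : ∃ l : Fin n, r ≤ l ∧ y j ≤ y l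
        · rw [if_pos hjx] at hj'; omega
        · have hji : j < i := by
            obtain ⟨l, hrl, hl⟩ := hi
            rcases hl.eq_or_lt with h1 | h1
            · obtain rfl := h.injective hm h1
              refine lt_of_not_ge fun hij => hjx ⟨j, hrl.trans ?_, le_rfl⟩
              exact hij
            · exact absurd ⟨l, hrl, hmin l h1⟩ hjx
          have := h.add_lt_of_lt hj hji
          omega
      · rw [if_neg hi]; omega

theorem sum_rank_eq_sum_rank_from_top :
    ∑ i, (Finset.univ.filter fun j => y j < y i).card =
      ∑ i, (Finset.univ.filter fun j => y i < y j).card := by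
  simp only [Finset.card_filter]
  exact Finset.sum_comm

/-- Each pair of distinct indices contributes to exactly one rank. -/
theorem two_mul_sum_rank (hy : Function.Injective y) :
    2 * ∑ i, (Finset.univ.filter fun j => y j < y i).card = n * (n - 1) := by
  have hrow : ∀ i, (Finset.univ.filter fun j => y j < y i).card +
      (Finset.univ.filter fun j => y i < y j).card = n - 1 := by
    intro i
    rw [← Finset.card_union_of_disjoint, ← Finset.filter_or]
    · have : (Finset.univ.filter fun j => y j < y i ∨ y i < y j) = Finset.univ.erase i := by
        ext j
        simp [hy.ne_iff]
      rw [this, Finset.card_erase_of_mem (Finset.mem_univ _), Finset.card_univ, Fintype.card_fin]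
    · exact Finset.disjoint_filter.2 fun j _ h1 h2 => absurd h1 h2.not_gt
  rw [two_mul]
  nth_rewrite 2 [sum_rank_eq_sum_rank_from_top]
  rw [← Finset.sum_add_distrib]
  simp [hrow]

/-- The maximal sum. The exponents `K - 1` on the indices from `r` on lower the bound by one each,
whatever the order of the values. -/
theorem two_mul_sum_le (h : IsGapped m y) (hm : 1 ≤ m) {K r : ℕ} (hK : ∀ i, y i ≤ K)
    (hr : ∀ i : Fin n, r ≤ i → y i < K) :
    2 * ∑ i, y i + m * (n * (n - 1)) ≤ 2 * ∑ i : Fin n, (if r ≤ (i : ℕ) then K - 1 else K) := by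
  rw [← two_mul_sum_rank (h.injective hm), mul_left_comm, ← mul_add,
    sum_rank_eq_sum_rank_from_top, Finset.mul_sum, ← Finset.sum_add_distrib]
  gcongr with i
  have := h.add_mul_rank_add_le hm hK hr i
  split_ifs with hi
  · rw [if_pos ⟨i, hi, le_rfl⟩] at this; omega
  · exact le_of_add_le_left this

/-- Only the arithmetic progression `0, m, 2 * m, …`, in the order of the indices, attains the
minimal sum. -/
theorem eq_mul_of_two_mul_sum_le (h : IsGapped m y) (hm : 1 ≤ m)
    (hle : 2 * ∑ i, y i ≤ m * (n * (n - 1))) (i : Fin n) : y i = i * m := by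
  have hlow := h.mul_rank_add_le hm
  have hsum : ∑ i, m * (Finset.univ.filter fun j => y j < y i).card = ∑ i, y i := by
    refine le_antisymm (Finset.sum_le_sum fun i _ => le_of_add_le_left (hlow i)) ?_
    rw [← two_mul_sum_rank (h.injective hm), mul_left_comm] at hle
    rw [← Finset.mul_sum]
    exact Nat.le_of_mul_le_mul_left hle two_pos
  have heq := (Finset.sum_eq_sum_iff_of_le fun i _ => le_of_add_le_left (hlow i)).1 hsum
  -- Equality in `mul_rank_add_le` leaves no room for a descent, so `y` is increasing.
  have hmono : ∀ a b : Fin n, y a < y b → a < b := by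
    intro a b hab
    rcases lt_trichotomy a b with h1 | h1 | h1
    · exact h1
    · subst h1; omega
    · have h2 := hlow b
      rw [if_pos ⟨a, h1, hab⟩, heq b (Finset.mem_univ _)] at h2
      omega
  have hset : (Finset.univ.filter fun j => y j < y i) = Finset.Iio i := by
    ext j
    simp only [Finset.mem_filter, Finset.mem_univ, true_and, Finset.mem_Iio]
    refine ⟨hmono j i, fun hji => ?_⟩
    rcases lt_trichotomy (y j) (y i) with h1 | h1 | h1
    · exact h1
    · exact absurd (h.injective hm h1) hji.ne
    · exact absurd (hmono i j h1) hji.not_gt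
  rw [← heq i (Finset.mem_univ _), hset, Fin.card_Iio, mul_comm]

end IsGapped

/-! ### The polynomial that detects restricted sums -/

/-- The pairs `⟨j, i⟩` with `i < j`, larger index first. -/
def ltPairs (n : ℕ) : Finset ((_ : Fin n) × Fin n) := Finset.univ.sigma fun j => Finset.Iio j

theorem two_mul_sum_fin (n : ℕ) : 2 * ∑ i : Fin n, (i : ℕ) = n * (n - 1) := by
  rw [Fin.sum_univ_eq_sum_range fun i => i, mul_comm, Finset.sum_range_id_mul_two]

theorem two_mul_card_ltPairs (n : ℕ) : 2 * (ltPairs n).card = n * (n - 1) := by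
  simp [ltPairs, Finset.card_sigma, two_mul_sum_fin]

section gapSumPoly

open MvPolynomial

variable {R : Type*} [CommRing R] {n d N : ℕ}

/-- The homogeneous linear forms `X j - X i` (with `d` copies of each) and `∑ i, X i` (with `N`
copies), jointly indexed. -/
noncomputable def gapSumForm (R : Type*) [CommRing R] (n d N : ℕ) :
    ((_ : Fin n) × Fin n) × Fin d ⊕ Fin N → MvPolynomial (Fin n) R :=
  Sum.elim (fun q => X q.1.1 - X q.1.2) fun _ => ∑ i, X i

/-- The polynomial `(∏ i < j, ∏ t, (X j - X i - u t)) * ∏ t, (∑ i, X i - v t)`: it is nonzero at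
`y` exactly when no difference `y j - y i` with `i < j` is a value of `u` and the sum of the `y i`
is not a value of `v`. -/
noncomputable def gapSumPoly (n : ℕ) (u : Fin d → R) (v : Fin N → R) : MvPolynomial (Fin n) R :=
  ∏ q ∈ (ltPairs n ×ˢ Finset.univ).disjSum Finset.univ,
    (gapSumForm R n d N q - C (Sum.elim (fun q => u q.2) v q))

theorem totalDegree_gapSumForm_le [Nontrivial R] (q : ((_ : Fin n) × Fin n) × Fin d ⊕ Fin N) :
    (gapSumForm R n d N q).totalDegree ≤ 1 := by
  rcases q with q | q
  · exact (totalDegree_sub _ _).trans (by simp)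
  · exact (totalDegree_finsetSum_le fun i _ => (totalDegree_X (R := R) i).le :
      (∑ i : Fin n, (X i : MvPolynomial (Fin n) R)).totalDegree ≤ 1)

theorem card_gapSum_index (n d N : ℕ) :
    ((ltPairs n ×ˢ (Finset.univ : Finset (Fin d))).disjSum (Finset.univ : Finset (Fin N))).card =
      (ltPairs n).card * d + N := by
  simp [Finset.card_disjSum]

theorem totalDegree_gapSumPoly_le [Nontrivial R] (u : Fin d → R) (v : Fin N → R) :
    (gapSumPoly n u v).totalDegree ≤ (ltPairs n).card * d + N :=
  (totalDegree_prod_sub_C_le _ _ _ fun q _ => totalDegree_gapSumForm_le q).trans_eq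
    (card_gapSum_index n d N)

theorem coeff_gapSumPoly_eq [Nontrivial R] (u u' : Fin d → R) (v v' : Fin N → R)
    (t : Fin n →₀ ℕ) (ht : (ltPairs n).card * d + N ≤ t.degree) :
    coeff t (gapSumPoly n u v) = coeff t (gapSumPoly n u' v') := by
  rw [← card_gapSum_index] at ht
  rw [gapSumPoly, gapSumPoly,
    coeff_prod_sub_C _ _ _ (fun q _ => totalDegree_gapSumForm_le q) t ht,
    coeff_prod_sub_C _ _ _ (fun q _ => totalDegree_gapSumForm_le q) t ht]

theorem eval_gapSumPoly_ne_zero_iff [IsDomain R] (u : Fin d → R) (v : Fin N → R) (y : Fin n → R) :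
    eval y (gapSumPoly n u v) ≠ 0 ↔
      (∀ i j, i < j → ∀ t, y j - y i ≠ u t) ∧ ∀ t, ∑ i, y i ≠ v t := by
  rw [gapSumPoly, map_prod, Finset.prod_ne_zero_iff]
  constructor
  · intro h
    refine ⟨fun i j hij t => ?_, fun t => ?_⟩
    · simpa [gapSumForm, sub_eq_zero] using
        h (Sum.inl (⟨j, i⟩, t)) (by simp [ltPairs, hij])
    · simpa [gapSumForm, sub_eq_zero] using h (Sum.inr t) (by simp)
  · rintro ⟨h1, h2⟩ (⟨⟨j, i⟩, t⟩ | t) hq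
    · simpa [gapSumForm, sub_eq_zero] using h1 i j (by simpa [ltPairs] using hq) t
    · simpa [gapSumForm, sub_eq_zero] using h2 t

end gapSumPoly

/-! ### The nonvanishing coefficient -/

/-- Every `M` is a sum of `n` numbers equal to `K` for the first `r` indices and to `K - 1` for the
others, where `K` is `M / n` rounded up. -/
theorem exists_balanced_bound (n M : ℕ) (hn : 1 ≤ n) :
    ∃ K r : ℕ, n * K < M + n ∧ M ≤ n * K ∧
      ∑ i : Fin n, (if r ≤ (i : ℕ) then K - 1 else K) = M := by
  obtain ⟨K, d, hd, hK⟩ : ∃ K d, d < n ∧ n * K = M + d := by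
    refine ⟨(M + (n - 1)) / n, n - 1 - (M + (n - 1)) % n, by omega, ?_⟩
    have h1 := Nat.div_add_mod (M + (n - 1)) n
    have h2 := Nat.mod_lt (M + (n - 1)) hn
    omega
  refine ⟨K, n - d, by omega, by omega, ?_⟩
  have hcard : ∑ i : Fin n, (if n - d ≤ (i : ℕ) then 1 else 0) = d := by
    rw [Fin.sum_univ_eq_sum_range fun i => if n - d ≤ i then 1 else 0, ← Finset.card_filter]
    have : (Finset.range n).filter (fun i => n - d ≤ i) = Finset.Ico (n - d) n := by
      ext i; simp [and_comm]
    rw [this, Nat.card_Ico]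
    omega
  have hsum : ∑ i : Fin n, (if n - d ≤ (i : ℕ) then K - 1 else K) +
      ∑ i : Fin n, (if n - d ≤ (i : ℕ) then 1 else 0) = n * K := by
    rw [← Finset.sum_add_distrib]
    have : ∀ i : Fin n, (if n - d ≤ (i : ℕ) then K - 1 else K) +
        (if n - d ≤ (i : ℕ) then 1 else 0) = K := by
      intro i
      split_ifs with hi
      · have hK0 : K ≠ 0 := by
          rintro rfl
          have := i.2
          omega
        omega
      · rfl
    rw [Finset.sum_congr rfl fun i _ => this i]
    simp
  omega

open MvPolynomial in
/-- The top-degree coefficient of `gapSumPoly` at `t` does not depend on `u` and `v`. For `u`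
running through `-m, …, m - 1` and `v` through the `N` integers above the minimal sum
`m * (n * (n - 1) / 2)` of a gapped tuple, the only point of the grid `∏ i, {0, …, t i}` at which
the polynomial does not vanish is `(0, m, …, (n - 1) * m)`. -/
theorem coeff_gapSumPoly_ne_zero {p n m N K r : ℕ} [Fact p.Prime] (hm : 1 ≤ m) (hnm : n * m < p)
    (hN : N < p) (hKp : K < p) (hK : (n - 1) * m < K) (t : Fin n →₀ ℕ)
    (ht : ∀ i, t i = if r ≤ (i : ℕ) then K - 1 else K)
    (hdeg : t.degree = m * (n * (n - 1)) + N) (u : Fin (2 * m) → ZMod p) (v : Fin N → ZMod p) :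
    coeff t (gapSumPoly n u v) ≠ 0 := by
  have hpairs := two_mul_card_ltPairs n
  have hdeg' : (ltPairs n).card * (2 * m) + N = t.degree := by rw [hdeg, ← hpairs]; ring
  have hQ := two_mul_sum_fin n
  set Q : ℕ := ∑ i : Fin n, (i : ℕ) with hQdef
  have htK : ∀ i, t i ≤ K := fun i => by rw [ht]; split_ifs <;> omega
  have hcast : ∀ a b : ℕ, a < p → b < p → (a : ZMod p) = b → a = b := by
    intro a b ha hb hab
    rwa [ZMod.natCast_eq_natCast_iff', Nat.mod_eq_of_lt ha, Nat.mod_eq_of_lt hb] at hab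
  have hcast0 : ∀ a : ℕ, 0 < a → a < p → (a : ZMod p) ≠ 0 := by
    intro a ha hap h0
    exact ha.ne' (hcast a 0 hap (ha.trans hap) (by simpa using h0))
  -- A pair of indices with forbidden difference is detected by `u`, a sum above `m * Q` by `v`.
  rw [coeff_gapSumPoly_eq u (fun s => (s : ZMod p) - m) v (fun s => (m * Q + 1 + s : ℕ)) t hdeg'.le]
  refine coeff_ne_zero_of_unique_eval_ne_zero _ t
    ((totalDegree_gapSumPoly_le _ _).trans_eq hdeg')
    (fun i => (Finset.range (t i + 1)).image (Nat.cast : ℕ → ZMod p)) ?_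
    (fun i => ((i * m : ℕ) : ZMod p)) ?_ ?_ ?_
  · intro i
    rw [Finset.card_image_of_injOn, Finset.card_range]
    intro a ha b hb hab
    have h1 := htK i
    simp only [Finset.coe_range, Set.mem_Iio] at ha hb
    exact hcast a b (by omega) (by omega) hab
  · intro i
    refine Finset.mem_image_of_mem _ (Finset.mem_range.2 ?_)
    have h1 : (i : ℕ) * m ≤ (n - 1) * m := Nat.mul_le_mul_right m (by have := i.2; omega)
    rw [ht]
    split_ifs <;> omega
  · rw [eval_gapSumPoly_ne_zero_iff]
    constructor
    · intro i j hij s h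
      have hs := s.2
      have h1 : ((i : ℕ) + 1) * m ≤ j * m := Nat.mul_le_mul_right m hij
      have h2 : ((j : ℕ) + 1) * m ≤ n * m := Nat.mul_le_mul_right m j.2
      rw [Nat.add_mul, one_mul] at h1 h2
      refine hcast0 (j * m + m - (i * m + s)) (by omega) (by omega) ?_
      rw [Nat.cast_sub (by omega)]
      push_cast at h ⊢
      linear_combination h
    · intro s h
      have hs := s.2
      refine hcast0 (1 + s) (by omega) (by omega) ?_
      have hsum : ∑ i : Fin n, (((i : ℕ) * m : ℕ) : ZMod p) = ((m * Q : ℕ) : ZMod p) := by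
        rw [← Nat.cast_sum, ← Finset.sum_mul, mul_comm]
      rw [hsum] at h
      push_cast at h ⊢
      linear_combination -h
  · intro y hy hyc
    by_contra hne
    obtain ⟨hgap, hsum⟩ := (eval_gapSumPoly_ne_zero_iff _ _ y).1 hne
    have hy' : ∀ i, ∃ z : ℕ, z ≤ t i ∧ (z : ZMod p) = y i := by
      intro i
      obtain ⟨z, hz, hzy⟩ := Finset.mem_image.1 (hy i)
      exact ⟨z, Nat.lt_succ_iff.1 (Finset.mem_range.1 hz), hzy⟩
    choose z hzt hzy using hy'
    have hz : IsGapped m z := by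
      intro i j hij
      by_contra! hcon
      refine hgap i j hij ⟨z j + m - z i, by omega⟩ ?_
      rw [← hzy, ← hzy, Nat.cast_sub (by omega)]
      push_cast
      ring
    -- The sum of `z` exceeds the minimum by at most `N`, so `v` covers all values but the minimum.
    have hub := hz.two_mul_sum_le hm (K := K) (r := r) (fun i => (hzt i).trans (htK i)) (by
      intro i hi
      have := hzt i
      rw [ht, if_pos hi] at this
      omega)
    simp_rw [← ht] at hub
    rw [← Finsupp.degree_eq_sum, hdeg, ← hQ, mul_left_comm] at hub
    apply hyc
    funext i
    rw [← hzy]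
    congr 1
    refine hz.eq_mul_of_two_mul_sum_le hm ?_ i
    rw [← hQ, mul_left_comm]
    by_contra! hcon
    refine hsum ⟨∑ i, z i - (m * Q + 1), by omega⟩ ?_
    simp_rw [← hzy]
    rw [← Nat.cast_sum]
    congr 1
    show _ = m * Q + 1 + (_ - _)
    omega

/-- For any forbidden differences `u` and forbidden sums `v`, a large enough set `A` contains a
tuple that avoids them. -/
theorem exists_eval_gapSumPoly_ne_zero {p n m N : ℕ} [Fact p.Prime] (hm : 1 ≤ m) (hn : 1 ≤ n)
    (hnm : n * m < p) (hN0 : 1 ≤ N) (hN : N < p) (A : Finset (ZMod p))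
    (hA : m * (n * (n - 1)) + N ≤ n * (A.card - 1))
    (u : Fin (2 * m) → ZMod p) (v : Fin N → ZMod p) :
    ∃ a : Fin n → ZMod p, (∀ i, a i ∈ A) ∧ MvPolynomial.eval a (gapSumPoly n u v) ≠ 0 := by
  obtain ⟨K, r, hK1, hK2, hsum⟩ := exists_balanced_bound n (m * (n * (n - 1)) + N) hn
  have hKA : K ≤ A.card - 1 := by
    refine Nat.lt_succ_iff.1 (Nat.lt_of_mul_lt_mul_left (a := n) ?_)
    rw [Nat.succ_eq_add_one, Nat.mul_add, Nat.mul_one]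
    omega
  have hKm : (n - 1) * m < K := by
    refine Nat.lt_of_mul_lt_mul_left (a := n) ?_
    have : n * ((n - 1) * m) = m * (n * (n - 1)) := by ring
    omega
  have hAp : A.card ≤ p := (Finset.card_le_univ A).trans_eq (ZMod.card p)
  set t : Fin n →₀ ℕ :=
    Finsupp.equivFunOnFinite.symm fun i => if r ≤ (i : ℕ) then K - 1 else K with htdef
  have ht : ∀ i, t i = if r ≤ (i : ℕ) then K - 1 else K := fun i => rfl
  have hdeg : t.degree = m * (n * (n - 1)) + N := by
    rw [Finsupp.degree_eq_sum, ← hsum]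
    rfl
  have hcoeff := coeff_gapSumPoly_ne_zero hm hnm hN (by omega) hKm t ht hdeg u v
  have htd : (gapSumPoly n u v).totalDegree = t.degree := by
    refine le_antisymm ((totalDegree_gapSumPoly_le u v).trans_eq ?_)
      (MvPolynomial.le_totalDegree (MvPolynomial.mem_support_iff.2 hcoeff))
    rw [hdeg, ← two_mul_card_ltPairs]
    ring
  refine MvPolynomial.combinatorial_nullstellensatz_exists_eval_nonzero _ t hcoeff htd
    (fun _ => A) fun i => ?_
  rw [ht]
  split_ifs <;> omega

/-! ### Restricted sums in `ZMod p` -/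

/-- The integral form of the theorem: `u` runs through `S` and `-S`, and `v` through all residues
other than `x`. -/
theorem exists_restricted_sum {p n m : ℕ} [Fact p.Prime] (hm : 1 ≤ m) (hn : 1 ≤ n)
    (hnm : n * m < p) (S A : Finset (ZMod p)) (hS : S.card = m)
    (hA : m * (n * (n - 1)) + (p - 1) ≤ n * (A.card - 1)) (x : ZMod p) :
    ∃ a : Fin n → ZMod p,
      (∀ i, a i ∈ A) ∧ (∀ i j, i ≠ j → a i - a j ∉ S) ∧ x = ∑ i, a i := by
  have hp : 2 ≤ p := (Fact.out : p.Prime).two_le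
  let e : S ⊕ S ≃ Fin (2 * m) := Fintype.equivFinOfCardEq (by simp [hS, two_mul])
  let e' : {c : ZMod p // c ≠ x} ≃ Fin (p - 1) := Fintype.equivFinOfCardEq (by
    rw [Fintype.card_subtype_compl, ZMod.card, Fintype.card_subtype_eq])
  obtain ⟨a, haA, ha⟩ := exists_eval_gapSumPoly_ne_zero hm hn hnm (by omega) (by omega) A hA
    (fun t => Sum.elim (fun s : S => (s : ZMod p)) (fun s : S => -(s : ZMod p)) (e.symm t))
    (fun t => (e'.symm t : ZMod p))
  rw [eval_gapSumPoly_ne_zero_iff] at ha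
  refine ⟨a, haA, fun i j hij hmem => ?_, ?_⟩
  · rcases lt_or_gt_of_ne hij with h | h
    · exact ha.1 i j h (e (Sum.inr ⟨_, hmem⟩)) (by simp)
    · exact ha.1 j i h (e (Sum.inl ⟨_, hmem⟩)) (by simp)
  · by_contra hne
    exact ha.2 (e' ⟨_, Ne.symm hne⟩) (by simp)

/-- The consequences of the square-root bound that the argument needs. Writing
`k - 1 + m = 2 * m * n + ρ` with `0 ≤ ρ ≤ 2 * m - 1`, one has
`4 * m * n * (k - 1 + m - m * n) = (k - 1 + m) ^ 2 - ρ ^ 2`, which is more than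
`4 * m * (p - 2)`. -/
theorem size_bounds {p m k n : ℕ} (hp : 2 ≤ p) (hm : 1 ≤ m) (hmp : m ≤ p) (hkp : k ≤ p)
    (hk : (k : ℝ) ≥
      Real.sqrt (4 * (m : ℝ) * (p : ℝ) + 4 * (m : ℝ) * ((m : ℝ) - 3) + 2) - (m : ℝ) + 1)
    (hn : n = ⌊((k : ℝ) - 1 + (m : ℝ)) / (2 * (m : ℝ))⌋₊) :
    1 ≤ n ∧ n * m < p ∧ m * (n * (n - 1)) + (p - 1) ≤ n * (k - 1) := by
  have hp' : (2 : ℝ) ≤ p := by exact_mod_cast hp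
  have hm' : (1 : ℝ) ≤ m := by exact_mod_cast hm
  have hsq : (4 * (m : ℝ) * (p : ℝ) + 4 * (m : ℝ) * ((m : ℝ) - 3) + 2) ≤
      ((k : ℝ) + m - 1) ^ 2 := (Real.sqrt_le_iff.1 (by linarith)).2
  have hnonneg : (0 : ℝ) ≤ (k : ℝ) + m - 1 := (Real.sqrt_nonneg _).trans (by linarith)
  have hlow : (n : ℝ) * (2 * m) ≤ k - 1 + m := by
    rw [← le_div_iff₀ (by positivity), hn]
    exact Nat.floor_le (div_nonneg (by linarith) (by positivity))
  have hup : (k : ℝ) - 1 + m < (n + 1) * (2 * m) := by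
    rw [← div_lt_iff₀ (by positivity), hn]
    exact Nat.lt_floor_add_one _
  have hlowZ : (n : ℤ) * (2 * m) ≤ k - 1 + m := by exact_mod_cast hlow
  have hupZ : (k : ℤ) - 1 + m + 1 ≤ (n + 1) * (2 * m) := by
    have : (k : ℤ) - 1 + m < (n + 1) * (2 * m) := by exact_mod_cast hup
    omega
  have hsqZ : (4 * (m : ℤ) * p + 4 * m * (m - 3) + 2) ≤ ((k : ℤ) + m - 1) ^ 2 := by
    exact_mod_cast hsq
  have hpZ : (2 : ℤ) ≤ p := by exact_mod_cast hp
  have hmZ : (1 : ℤ) ≤ m := by exact_mod_cast hm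
  have hrem : ((k : ℤ) - 1 + m - 2 * m * n) ^ 2 ≤ (2 * m - 1) ^ 2 :=
    pow_le_pow_left₀ (by linarith) (by linarith) 2
  have hkey : (p : ℤ) - 1 ≤ n * (k - 1 + m - m * n) := by
    have : 4 * (m : ℤ) * (p - 2) < 4 * m * (n * (k - 1 + m - m * n)) := by nlinarith
    have := lt_of_mul_lt_mul_left this (by positivity)
    linarith
  have hn1 : 1 ≤ n := by
    rcases Nat.eq_zero_or_pos n with h | h
    · rw [h] at hkey
      push_cast at hkey
      linarith
    · exact h
  have hk1 : 1 ≤ k := by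
    by_contra! h0
    have hk0 : k = 0 := by omega
    rw [hk0] at hlowZ
    have : (1 : ℤ) ≤ n := by exact_mod_cast hn1
    push_cast at hlowZ
    nlinarith
  refine ⟨hn1, ?_, ?_⟩
  · have hmpZ : (m : ℤ) ≤ p := by exact_mod_cast hmp
    have hkpZ : (k : ℤ) ≤ p := by exact_mod_cast hkp
    zify
    linarith
  · zify [hn1, hk1, (by omega : 1 ≤ p)]
    linarith

theorem theorem1p4 (p : ℕ) (hp : p.Prime) (m : ℕ) (hm : 1 ≤ m)
    (S A : Finset (ZMod p)) (hS : S.card = m)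
    (hA : (A.card : ℝ) ≥
      Real.sqrt (4 * (m : ℝ) * (p : ℝ) + 4 * (m : ℝ) * ((m : ℝ) - 3) + 2) - (m : ℝ) + 1)
    (n : ℕ) (hn : n = ⌊((A.card : ℝ) - 1 + (m : ℝ)) / (2 * (m : ℝ))⌋₊) (x : ZMod p) :
    ∃ a : Fin n → ZMod p,
      (∀ i, a i ∈ A) ∧ (∀ i j, i ≠ j → a i - a j ∉ S) ∧ x = ∑ i, a i := by
  have : Fact p.Prime := ⟨hp⟩
  have hcard : ∀ T : Finset (ZMod p), T.card ≤ p := fun T =>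
    (Finset.card_le_univ T).trans_eq (ZMod.card p)
  obtain ⟨hn1, hnm, hsize⟩ := size_bounds hp.two_le hm (hS ▸ hcard S) (hcard A) hA hn
  exact exists_restricted_sum hm hn1 hnm S A hS hsize x
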